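/- For $t\in\mathbb N$ let $B_t$ be the book with $t$ pages, i.e. the graph consisting of $t$ triangles that share one common edge and are otherwise vertex-disjoint ($B_0$ being a single edge). In the unbiased Maker-Breaker $H$-game on a finite graph $G$, the two players Maker and Breaker alternately claim one previously unclaimed edge of $G$ each, until all edges are claimed; Maker wins if she has claimed all edges of some (not necessarily induced) copy of $H$ in $G$, and otherwise Breaker wins. Let $G_{n,p}$ be the binomial random graph on $n$ vertices, in which every pair of vertices is an edge with probability $p$ independently of all others. **Proposition.** Let $t\in\mathbb N$ and $H=B_t$, let $\alpha>0$, let $(G_\alpha^{(n)})_{n}$ be a sequence of graphs, $G_\alpha^{(n)}$ having $n$ vertices and minimum degree $\delta(G_\alpha^{(n)})\ge \alpha n$ for all sufficiently large $n$, and let $p=p(n)\in[0,1]$ satisfy $p=\omega(n^{-2})$, i.e. $p(n)\,n^2\to\infty$. Then, no matter which of the two players makes the first move, $$\lim_{n\to\infty}\mathbb P\bigl(\text{Maker has a winning strategy in the unbiased Maker-Breaker } H\text{-game on } G_\alpha^{(n)}\cup G_{n,p}\bigr)=1,$$ where $G_{n,p}$ is taken on the vertex set of $G_\alpha^{(n)}$.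 -/

import Mathlib

open Filter Topology Asymptotics

/-- The two players of a Maker-Breaker game. -/
inductive Player : Type
  | maker
  | breaker

/-- The opponent of a player. -/
def Player.other : Player → Player
  | .maker => .breaker
  | .breaker => .maker

/-- In the unbiased game the players alternate, each claiming one element per turn.
Moves are numbered `0, 1, 2, …`, and `toMove first i` is the player making move number `i`
when the player `first` starts the game. -/
def toMove (first : Player) (i : ℕ) : Player :=
  if Even i then first else first.other

/-- A (deterministic) strategy on the board `X`. It is given the history of the game, i.e. the list
of all elements claimed so far by both players in chronological order, and answers with the element
to claim next. As long as the board is not exhausted, the answer has to be an unclaimed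
element of the board (the value `none` can only occur when there is no unclaimed element left,
or at lists which are not the history of a game on `X`). -/
structure Strategy {β : Type*} (X : Finset β) where
  next : List β → Option β
  legal : ∀ h : List β, h.Nodup → (∀ x ∈ h, x ∈ X) → (∃ x ∈ X, x ∉ h) →
    ∃ x ∈ X, x ∉ h ∧ next h = some x

/-- A complete play on the board `X`: a list in which every element of the board is claimed
exactly once. -/
def IsPlay {β : Type*} (X : Finset β) (l : List β) : Prop :=
  l.Nodup ∧ ∀ x, x ∈ l ↔ x ∈ X

/-- All the moves of player `q` in the play `l` are made according to the strategy `s`. -/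
def FollowedBy {β : Type*} {X : Finset β} (s : Strategy X) (first q : Player) (l : List β) : Prop :=
  ∀ i < l.length, toMove first i = q → l[i]? = s.next (l.take i)

/-- The set of elements claimed by player `q` in the play `l`. -/
def claimed {β : Type*} (first q : Player) (l : List β) : Set β :=
  {x | ∃ i, toMove first i = q ∧ l[i]? = some x}

/-- Maker has a winning strategy in the unbiased Maker-Breaker game on the hypergraph `(X, 𝓕)`
in which `first` makes the first move: whatever Breaker does, Maker fully claims an element
of `𝓕`. -/
def MakerWins {β : Type*} (first : Player) (X : Finset β) (𝓕 : Set (Set β)) : Prop :=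
  ∃ s : Strategy X, ∀ l : List β, IsPlay X l → FollowedBy s first .maker l →
    ∃ F ∈ 𝓕, F ⊆ claimed first .maker l

/-- The edge sets of the (not necessarily induced) copies of `H` in `G`. -/
def copyEdgeSets {W V : Type*} (H : SimpleGraph W) (G : SimpleGraph V) : Set (Set (Sym2 V)) :=
  {F | ∃ f : SimpleGraph.Copy H G, F = Sym2.map f '' H.edgeSet}

open Classical in
/-- Maker has a winning strategy in the unbiased Maker-Breaker `H`-game played on the edges
of `G`. -/
def MakerWinsGraphGame {W V : Type*} [Fintype V] (first : Player)
    (H : SimpleGraph W) (G : SimpleGraph V) : Prop :=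
  MakerWins first G.edgeFinset (copyEdgeSets H G)

/-- The book with `t` pages: `t` triangles sharing one common edge. The two vertices `Sum.inl _`
span the common edge, the vertices `Sum.inr _` are the third vertices of the `t` triangles;
two distinct vertices are adjacent unless both of them are of the second kind. -/
def bookGraph (t : ℕ) : SimpleGraph (Fin 2 ⊕ Fin t) :=
  SimpleGraph.fromRel fun u _ => u.isLeft = true

/-! Let x be the expected number of edges of the random graph R, so x → ∞ although R may be very
sparse. Call two edges of R joined if all four pairs between them are edges of G. By the minimum
degree, G contains order n⁴ copies of K_{2,2}, so a positive proportion of all pairs of potential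
edges are joined, while only O(n³) ordered pairs share a vertex. Pairs spanned by R inherit both
proportions up to constants with probability 1 - O(1/x), by Chebyshev
(`bernoulliExp_pairCount_deviation`).

The joined relation on the edges of R is then dense, and a Kővári–Sós–Turán count yields K_{s,s} in
it; since few pairs meet, both sides can be taken to be matchings (`exists_biclique_of_dense`, with
s = 2(2t+1)).

On this structure Maker wins by pairing (`makerWinsGraphGame_book`), whoever starts. The matching
edges on each side are grouped in twos, so she gets 2t+1 edges per side. Between two matching edges,
each of the two diagonals (perfect matchings) of the K_{2,2} is a pair; one edge from each gives two
edges meeting in a vertex, so one matching edge forms a Maker-coloured cherry with an end of the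
other. If both matching edges are hers, this is a triangle. By pigeonhole some edge of hers is the
spine of t such triangles. -/

/-! ### Moments and concentration for random subsets -/

section BernoulliExpectation

variable {β : Type*}

/-- The expectation of `f T`, where `T` is a random subset of `P` containing every element of `P`
independently with probability `p`. -/
noncomputable def bernoulliExp (p : ℝ) (P : Finset β) (f : Finset β → ℝ) : ℝ :=
  ∑ T ∈ P.powerset, p ^ T.card * (1 - p) ^ (P.card - T.card) * f T

lemma bernoulliExp_congr (p : ℝ) (P : Finset β) {f g : Finset β → ℝ}
    (h : ∀ T ⊆ P, f T = g T) : bernoulliExp p P f = bernoulliExp p P g :=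
  Finset.sum_congr rfl fun T hT => by rw [h T (Finset.mem_powerset.1 hT)]

lemma bernoulliExp_mono {p : ℝ} (h0 : 0 ≤ p) (h1 : p ≤ 1) (P : Finset β) {f g : Finset β → ℝ}
    (h : ∀ T ⊆ P, f T ≤ g T) : bernoulliExp p P f ≤ bernoulliExp p P g :=
  Finset.sum_le_sum fun T hT => mul_le_mul_of_nonneg_left (h T (Finset.mem_powerset.1 hT))
    (mul_nonneg (pow_nonneg h0 _) (pow_nonneg (by linarith) _))

lemma bernoulliExp_add (p : ℝ) (P : Finset β) (f g : Finset β → ℝ) :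
    bernoulliExp p P (fun T => f T + g T) = bernoulliExp p P f + bernoulliExp p P g := by
  simp only [bernoulliExp, mul_add, Finset.sum_add_distrib]

lemma bernoulliExp_const_mul (p : ℝ) (P : Finset β) (c : ℝ) (f : Finset β → ℝ) :
    bernoulliExp p P (fun T => c * f T) = c * bernoulliExp p P f := by
  simp only [bernoulliExp, Finset.mul_sum]
  exact Finset.sum_congr rfl fun T _ => by ring

lemma bernoulliExp_sum {ι : Type*} (p : ℝ) (P : Finset β) (s : Finset ι)
    (f : ι → Finset β → ℝ) :
    bernoulliExp p P (fun T => ∑ i ∈ s, f i T) = ∑ i ∈ s, bernoulliExp p P (f i) := by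
  simp only [bernoulliExp, Finset.mul_sum]
  exact Finset.sum_comm

variable [DecidableEq β]

/-- Conditioning on whether `a` is chosen; this drives the inductions on `P` below. -/
lemma bernoulliExp_insert (p : ℝ) {P : Finset β} {a : β} (ha : a ∉ P) (f : Finset β → ℝ) :
    bernoulliExp p (insert a P) f =
      (1 - p) * bernoulliExp p P f + p * bernoulliExp p P (fun T => f (insert a T)) := by
  simp only [bernoulliExp, Finset.sum_powerset_insert ha, Finset.mul_sum,
    Finset.card_insert_of_notMem ha]
  congr 1
  · refine Finset.sum_congr rfl fun T hT => ?_
    have := Finset.card_le_card (Finset.mem_powerset.1 hT)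
    rw [Nat.succ_sub this, pow_succ]
    ring
  · refine Finset.sum_congr rfl fun T hT => ?_
    have haT : a ∉ T := fun h => ha (Finset.mem_powerset.1 hT h)
    rw [Finset.card_insert_of_notMem haT, Nat.add_sub_add_right, pow_succ]
    ring

lemma bernoulliExp_one (p : ℝ) (P : Finset β) : bernoulliExp p P (fun _ => 1) = 1 := by
  induction P using Finset.induction_on with
  | empty => simp [bernoulliExp]
  | insert a P ha ih => rw [bernoulliExp_insert p ha, ih]; ring

lemma bernoulliExp_const (p : ℝ) (P : Finset β) (c : ℝ) :
    bernoulliExp p P (fun _ => c) = c := by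
  simpa [bernoulliExp_one] using bernoulliExp_const_mul p P c (fun _ => 1)

lemma bernoulliExp_subset (p : ℝ) {P Q : Finset β} (hQ : Q ⊆ P) :
    bernoulliExp p P (fun T => if Q ⊆ T then 1 else 0) = p ^ Q.card := by
  induction P using Finset.induction_on generalizing Q with
  | empty => simp [bernoulliExp, Finset.subset_empty.1 hQ]
  | insert a P ha ih =>
    rw [bernoulliExp_insert p ha]
    by_cases haQ : a ∈ Q
    · have h1 : bernoulliExp p P (fun T => if Q ⊆ T then (1 : ℝ) else 0) = 0 := by
        refine (bernoulliExp_congr p P (g := fun _ => 0) fun T hT => if_neg fun h : Q ⊆ T =>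
          ha (hT (h haQ))).trans (bernoulliExp_const p P 0)
      have h2 : bernoulliExp p P (fun T => if Q ⊆ insert a T then (1 : ℝ) else 0) =
          p ^ (Q.erase a).card := by
        rw [← ih (Finset.subset_insert_iff.1 hQ)]
        simp only [Finset.subset_insert_iff]
      rw [h1, h2, ← Finset.card_erase_add_one haQ, pow_succ]
      ring
    · have hQP : Q ⊆ P := (Finset.subset_insert_iff_of_notMem haQ).1 hQ
      simp only [Finset.subset_insert_iff_of_notMem haQ, ih hQP]
      ring

/-- Binomial moments: the coefficients are Stirling numbers of the second kind, with falling
factorials of `P.card` bounded by powers. All four are proved together because each inductive step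
uses the lower moments. -/
lemma bernoulliExp_card_moments {p : ℝ} (h0 : 0 ≤ p) (P : Finset β) :
    bernoulliExp p P (fun T => (T.card : ℝ)) = P.card * p ∧
    bernoulliExp p P (fun T => (T.card : ℝ) ^ 2) ≤ (P.card * p) ^ 2 + P.card * p ∧
    bernoulliExp p P (fun T => (T.card : ℝ) ^ 3) ≤
      (P.card * p) ^ 3 + 3 * (P.card * p) ^ 2 + P.card * p ∧
    bernoulliExp p P (fun T => (T.card : ℝ) ^ 4) ≤
      (P.card * p) ^ 4 + 6 * (P.card * p) ^ 3 + 7 * (P.card * p) ^ 2 + P.card * p := by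
  induction P using Finset.induction_on with
  | empty => simp [bernoulliExp]
  | insert a P ha ih =>
    obtain ⟨h1, h2, h3, h4⟩ := ih
    have hins : ∀ k : ℕ, bernoulliExp p P (fun T => ((insert a T).card : ℝ) ^ k) =
        bernoulliExp p P (fun T => ((T.card : ℝ) + 1) ^ k) := fun k =>
      bernoulliExp_congr p P fun T hT => by
        rw [Finset.card_insert_of_notMem fun h => ha (hT h)]; push_cast; rfl
    have e1 : bernoulliExp p P (fun T => ((insert a T).card : ℝ)) =
        bernoulliExp p P (fun T => (T.card : ℝ)) + 1 := by
      have := hins 1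
      simp only [pow_one] at this
      rw [this, bernoulliExp_add, bernoulliExp_one]
    have e2 : bernoulliExp p P (fun T => ((insert a T).card : ℝ) ^ 2) =
        bernoulliExp p P (fun T => (T.card : ℝ) ^ 2) +
          2 * bernoulliExp p P (fun T => (T.card : ℝ)) + bernoulliExp p P (fun _ => 1) := by
      rw [hins, ← bernoulliExp_const_mul, ← bernoulliExp_add, ← bernoulliExp_add]
      exact bernoulliExp_congr p P fun T _ => by ring
    have e3 : bernoulliExp p P (fun T => ((insert a T).card : ℝ) ^ 3) =
        bernoulliExp p P (fun T => (T.card : ℝ) ^ 3) +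
          3 * bernoulliExp p P (fun T => (T.card : ℝ) ^ 2) +
          3 * bernoulliExp p P (fun T => (T.card : ℝ)) + bernoulliExp p P (fun _ => 1) := by
      rw [hins, ← bernoulliExp_const_mul, ← bernoulliExp_const_mul, ← bernoulliExp_add,
        ← bernoulliExp_add, ← bernoulliExp_add]
      exact bernoulliExp_congr p P fun T _ => by ring
    have e4 : bernoulliExp p P (fun T => ((insert a T).card : ℝ) ^ 4) =
        bernoulliExp p P (fun T => (T.card : ℝ) ^ 4) +
          4 * bernoulliExp p P (fun T => (T.card : ℝ) ^ 3) +
          6 * bernoulliExp p P (fun T => (T.card : ℝ) ^ 2) +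
          4 * bernoulliExp p P (fun T => (T.card : ℝ)) + bernoulliExp p P (fun _ => 1) := by
      rw [hins, ← bernoulliExp_const_mul, ← bernoulliExp_const_mul, ← bernoulliExp_const_mul,
        ← bernoulliExp_add, ← bernoulliExp_add, ← bernoulliExp_add, ← bernoulliExp_add]
      exact bernoulliExp_congr p P fun T _ => by ring
    rw [bernoulliExp_one] at e2 e3 e4
    simp only [bernoulliExp_insert p ha, e1, e2, e3, e4, Finset.card_insert_of_notMem ha, h1]
    push_cast
    set x : ℝ := P.card * p with hx
    have hx0 : 0 ≤ x := by positivity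
    rw [add_mul, one_mul, ← hx]
    have hp2 := mul_le_mul_of_nonneg_left h2 h0
    have hp3 := mul_le_mul_of_nonneg_left h3 h0
    refine ⟨by ring, by nlinarith [sq_nonneg p], ?_, ?_⟩
    · have : 0 ≤ x * p ^ 2 := by positivity
      have : 0 ≤ p ^ 3 := by positivity
      have : 0 ≤ p ^ 2 := by positivity
      nlinarith
    · have : 0 ≤ x ^ 2 * p ^ 2 := by positivity
      have : 0 ≤ x * p ^ 3 := by positivity
      have : 0 ≤ x * p ^ 2 := by positivity
      have : 0 ≤ p ^ 4 := by positivity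
      have : 0 ≤ p ^ 3 := by positivity
      have : 0 ≤ p ^ 2 := by positivity
      nlinarith

/-- The number of pairs of `Q` with both members in `T`. -/
noncomputable def pairCount (Q : Finset (β × β)) (T : Finset β) : ℝ :=
  ∑ q ∈ Q, if {q.1, q.2} ⊆ T then 1 else 0

lemma pairCount_sq (Q : Finset (β × β)) (T : Finset β) :
    pairCount Q T ^ 2 =
      ∑ q ∈ Q, ∑ r ∈ Q, if {q.1, q.2} ∪ {r.1, r.2} ⊆ T then (1 : ℝ) else 0 := by
  rw [pairCount, sq, Finset.sum_mul_sum]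
  refine Finset.sum_congr rfl fun q _ => Finset.sum_congr rfl fun r _ => ?_
  simp only [Finset.union_subset_iff, ite_and]
  split_ifs <;> simp

lemma pairCount_product {P T : Finset β} (hT : T ⊆ P) :
    pairCount (P ×ˢ P) T = (T.card : ℝ) ^ 2 := by
  rw [pairCount, Finset.sum_boole]
  have : ((P ×ˢ P).filter fun q => {q.1, q.2} ⊆ T) = T ×ˢ T := by
    ext ⟨a, b⟩
    simp only [Finset.mem_filter, Finset.mem_product, Finset.insert_subset_iff,
      Finset.singleton_subset_iff]
    exact ⟨fun h => h.2, fun h => ⟨⟨hT h.1, hT h.2⟩, h⟩⟩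
  rw [this, Finset.card_product]
  push_cast
  ring

/-- The centre is not the exact mean, as diagonal pairs have probability `p`, but it is at most the
mean. Hence the second moment about it is at most the sum over `q`, `r` of `p ^ |q ∪ r| - p ^ 4`.
These terms are nonnegative, so `Q` may be enlarged to `P ×ˢ P`, where the sum is the fourth moment
of `T.card` minus its leading term; 14 = 6 + 7 + 1. -/
lemma bernoulliExp_pairCount_variance {p : ℝ} (h0 : 0 ≤ p) (h1 : p ≤ 1) {P : Finset β}
    {Q : Finset (β × β)} (hQ : Q ⊆ P ×ˢ P) (hN : 1 ≤ P.card * p) :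
    bernoulliExp p P (fun T => (pairCount Q T - Q.card * p ^ 2) ^ 2) ≤
      14 * (P.card * p) ^ 3 := by
  have hsub : ∀ q ∈ P ×ˢ P, ({q.1, q.2} : Finset β) ⊆ P := fun q hq => by
    rw [Finset.mem_product] at hq
    simp [Finset.insert_subset_iff, hq.1, hq.2]
  have hE1 : (Q.card : ℝ) * p ^ 2 ≤ bernoulliExp p P (pairCount Q) := by
    unfold pairCount
    rw [bernoulliExp_sum, ← nsmul_eq_mul, ← Finset.sum_const]
    refine Finset.sum_le_sum fun q hq => ?_
    rw [bernoulliExp_subset p (hsub q (hQ hq))]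
    exact pow_le_pow_of_le_one h0 h1 Finset.card_le_two
  have hE2 : ∀ Q' ⊆ P ×ˢ P, bernoulliExp p P (fun T => pairCount Q' T ^ 2) =
      ∑ q ∈ Q', ∑ r ∈ Q', p ^ (({q.1, q.2} ∪ {r.1, r.2} : Finset β).card) := fun Q' hQ' => by
    simp only [pairCount_sq, bernoulliExp_sum]
    exact Finset.sum_congr rfl fun q hq => Finset.sum_congr rfl fun r hr =>
      bernoulliExp_subset p (Finset.union_subset (hsub q (hQ' hq)) (hsub r (hQ' hr)))
  have hsum : ∀ Q' : Finset (β × β),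
      ∑ q ∈ Q', ∑ r ∈ Q', (p ^ (({q.1, q.2} ∪ {r.1, r.2} : Finset β).card) - p ^ 4) =
      ∑ q ∈ Q', ∑ r ∈ Q', p ^ (({q.1, q.2} ∪ {r.1, r.2} : Finset β).card) -
        (Q'.card * p ^ 2) ^ 2 := fun Q' => by
    simp only [Finset.sum_sub_distrib, Finset.sum_const, nsmul_eq_mul]
    ring
  have hnonneg : ∀ q r : β × β,
      0 ≤ p ^ (({q.1, q.2} ∪ {r.1, r.2} : Finset β).card) - p ^ 4 := fun q r => by
    refine sub_nonneg.2 (pow_le_pow_of_le_one h0 h1 ((Finset.card_union_le _ _).trans ?_))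
    exact add_le_add Finset.card_le_two Finset.card_le_two
  have hle : ∑ q ∈ Q, ∑ r ∈ Q, (p ^ (({q.1, q.2} ∪ {r.1, r.2} : Finset β).card) - p ^ 4) ≤
      ∑ q ∈ P ×ˢ P, ∑ r ∈ P ×ˢ P,
        (p ^ (({q.1, q.2} ∪ {r.1, r.2} : Finset β).card) - p ^ 4) :=
    (Finset.sum_le_sum fun q _ => Finset.sum_le_sum_of_subset_of_nonneg hQ
      fun r _ _ => hnonneg q r).trans (Finset.sum_le_sum_of_subset_of_nonneg hQ
        fun q _ _ => Finset.sum_nonneg fun r _ => hnonneg q r)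
  rw [hsum, hsum, ← hE2 Q hQ, ← hE2 _ subset_rfl] at hle
  have hfour : bernoulliExp p P (fun T => pairCount (P ×ˢ P) T ^ 2) =
      bernoulliExp p P (fun T => (T.card : ℝ) ^ 4) :=
    bernoulliExp_congr p P fun T hT => by rw [pairCount_product hT]; ring
  have hexp : bernoulliExp p P (fun T => (pairCount Q T - Q.card * p ^ 2) ^ 2) =
      bernoulliExp p P (fun T => pairCount Q T ^ 2) +
        (-2 * (Q.card * p ^ 2)) * bernoulliExp p P (pairCount Q) +
        bernoulliExp p P (fun _ => (Q.card * p ^ 2) ^ 2) := by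
    rw [← bernoulliExp_const_mul, ← bernoulliExp_add, ← bernoulliExp_add]
    exact bernoulliExp_congr p P fun T _ => by ring
  have hm := (bernoulliExp_card_moments h0 P).2.2.2
  rw [hfour, Finset.card_product] at hle
  push_cast at hle
  have hq0 : 0 ≤ (Q.card : ℝ) * p ^ 2 := by positivity
  have hmul := mul_le_mul_of_nonneg_left hE1 hq0
  set x : ℝ := P.card * p
  have hx2 : x ^ 2 ≤ x ^ 3 := pow_le_pow_right₀ hN (by norm_num)
  have hx1 : x ≤ x ^ 3 := le_self_pow₀ hN (by norm_num)
  have hx4 : ((P.card : ℝ) * P.card * p ^ 2) ^ 2 = x ^ 4 := by simp only [x]; ring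
  rw [hx4] at hle
  rw [hexp, bernoulliExp_const]
  nlinarith

/-- Chebyshev's inequality for the number of pairs of `Q` spanned by a random subset of `P`. -/
lemma bernoulliExp_pairCount_deviation {p : ℝ} (h0 : 0 ≤ p) (h1 : p ≤ 1) {P : Finset β}
    {Q : Finset (β × β)} (hQ : Q ⊆ P ×ˢ P) (hN : 1 ≤ P.card * p) {ε : ℝ} (hε : 0 < ε) :
    bernoulliExp p P (fun T =>
      if ε * (P.card * p) ^ 2 < |pairCount Q T - Q.card * p ^ 2| then 1 else 0) ≤
      14 / (ε ^ 2 * (P.card * p)) := by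
  set x : ℝ := P.card * p with hx
  have hx0 : 0 < x := by linarith
  have hpos : 0 < (ε * x ^ 2) ^ 2 := by positivity
  calc _ ≤ bernoulliExp p P (fun T =>
        (1 / (ε * x ^ 2) ^ 2) * (pairCount Q T - Q.card * p ^ 2) ^ 2) := by
        refine bernoulliExp_mono h0 h1 P fun T _ => ?_
        split_ifs with h
        · rw [one_div, ← div_eq_inv_mul, one_le_div hpos, ← sq_abs (pairCount Q T - _)]
          exact pow_le_pow_left₀ (by positivity) h.le 2
        · positivity
    _ ≤ (1 / (ε * x ^ 2) ^ 2) * (14 * x ^ 3) := by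
        rw [bernoulliExp_const_mul]
        exact mul_le_mul_of_nonneg_left (bernoulliExp_pairCount_variance h0 h1 hQ hN)
          (by positivity)
    _ = 14 / (ε ^ 2 * x) := by field_simp

end BernoulliExpectation

/-! ### Bicliques in dense relations -/

section DenseRelation

open Finset

/-- Power mean inequality, in the form used twice in the biclique count. -/
lemma card_mul_pow_le_sum_pow {ι : Type*} [Fintype ι] [Nonempty ι] (f : ι → ℝ)
    (hf : ∀ i, 0 ≤ f i) {d : ℝ} (hd : 0 ≤ d) (h : d * Fintype.card ι ≤ ∑ i, f i) (s : ℕ) :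
    d ^ s * Fintype.card ι ≤ ∑ i, f i ^ s := by
  have hc : (0 : ℝ) < Fintype.card ι := by exact_mod_cast Fintype.card_pos
  rcases s with - | s
  · simp
  have h1 := pow_sum_div_card_le_sum_pow (s := univ) (f := f) (fun i _ => hf i) s
  refine le_trans ?_ h1
  rw [card_univ, le_div_iff₀ (by positivity)]
  calc d ^ (s + 1) * Fintype.card ι * (Fintype.card ι : ℝ) ^ s
      = (d * Fintype.card ι) ^ (s + 1) := by rw [mul_pow, pow_succ (Fintype.card ι : ℝ)]; ring
    _ ≤ _ := pow_le_pow_left₀ (by positivity) h _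

variable {β : Type*} [Fintype β]

lemma card_filter_forall_fin (s : ℕ) (p : β → Prop) [DecidablePred p] :
    #{a : Fin s → β | ∀ i, p (a i)} = #{x | p x} ^ s := by
  have : ({a : Fin s → β | ∀ i, p (a i)} : Finset _) =
      Fintype.piFinset fun _ => ({x | p x} : Finset β) := by
    ext a; simp
  rw [this, Fintype.card_piFinset_const]

lemma sum_card_filter_eq_card_filter_prod {γ : Type*} [Fintype γ] (r : β → γ → Prop)
    [∀ a b, Decidable (r a b)] :
    ∑ a, #{b | r a b} = #{q : β × γ | r q.1 q.2} := by
  simp only [card_filter, Fintype.sum_prod_type]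

/-- Two coordinates of a uniform tuple form a uniform pair. The injection exchanges coordinates `i`,
`j` of the tuple with the spare pair. -/
lemma card_filter_pair_le (s : ℕ) (Z : β → β → Prop) [∀ a b, Decidable (Z a b)] {i j : Fin s}
    (hij : i ≠ j) :
    #{a : Fin s → β | Z (a i) (a j)} * Fintype.card β ^ 2 ≤
      #{q : β × β | Z q.1 q.2} * Fintype.card β ^ s := by
  have key : #(({a : Fin s → β | Z (a i) (a j)} : Finset _) ×ˢ (univ : Finset (β × β))) ≤
      #(({q : β × β | Z q.1 q.2} : Finset _) ×ˢ (univ : Finset (Fin s → β))) := by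
    refine card_le_card_of_injOn
      (fun w => ((w.1 i, w.1 j), Function.update (Function.update w.1 i w.2.1) j w.2.2)) ?_ ?_
    · intro w hw
      simpa using hw
    · rintro ⟨a, x, y⟩ _ ⟨a', x', y'⟩ _ h
      simp only [Prod.mk.injEq] at h
      obtain ⟨⟨hi, hj⟩, hu⟩ := h
      have hy : y = y' := by simpa using congrFun hu j
      have hx : x = x' := by simpa [hij] using congrFun hu i
      have ha : a = a' := by
        funext k
        by_cases hkj : k = j
        · rw [hkj, hj]
        by_cases hki : k = i
        · rw [hki, hi]
        simpa [hkj, hki] using congrFun hu k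
      rw [ha, hx, hy]
  simpa [card_product, sq] using key

/-- A lower bound on the number of homomorphic copies of `K_{s,s}` in a dense relation. -/
lemma pow_mul_le_card_bicliques (Γ : β → β → Prop) [∀ a b, Decidable (Γ a b)] (s : ℕ) {c : ℝ}
    (hc : 0 ≤ c) (hβ : 0 < Fintype.card β)
    (hΓ : c * (Fintype.card β : ℝ) ^ 2 ≤ #{q : β × β | Γ q.1 q.2}) :
    c ^ (s * s) * ((Fintype.card β : ℝ) ^ s * (Fintype.card β : ℝ) ^ s) ≤
      #{q : (Fin s → β) × (Fin s → β) | ∀ j i, Γ (q.1 i) (q.2 j)} := by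
  have : Nonempty β := Fintype.card_pos_iff.1 hβ
  set N : ℝ := (Fintype.card β : ℝ) with hN
  have hN0 : 0 < N := by rw [hN]; exact_mod_cast hβ
  have hcardF : (Fintype.card (Fin s → β) : ℝ) = N ^ s := by simp [hN]
  -- Convexity over right endpoints `b` counts stars; regrouping them by their `s` leaves (`h2`) and
  -- using convexity again (`h3`) counts bicliques.
  have h1 : (c * N) ^ s * N ≤ ∑ b : β, (#{x | Γ x b} : ℝ) ^ s := by
    refine card_mul_pow_le_sum_pow (fun b => (#{x | Γ x b} : ℝ)) (fun _ => by positivity)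
      (by positivity) ?_ s
    have : ∑ b : β, #{x | Γ x b} = #{q : β × β | Γ q.1 q.2} := by
      rw [← sum_card_filter_eq_card_filter_prod]
      exact (sum_card_bipartiteAbove_eq_sum_card_bipartiteBelow Γ).symm
    rw [← hN]
    calc c * N * N = c * N ^ 2 := by ring
      _ ≤ _ := hΓ
      _ = _ := by rw [← this]; push_cast; rfl
  have h2 : ∑ a : Fin s → β, #{b | ∀ i, Γ (a i) b} = ∑ b : β, #{x | Γ x b} ^ s := by
    simp only [← card_filter_forall_fin]
    exact sum_card_bipartiteAbove_eq_sum_card_bipartiteBelow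
      (fun (a : Fin s → β) b => ∀ i, Γ (a i) b)
  have h3 : (c ^ s * N) ^ s * (N ^ s) ≤
      ∑ a : Fin s → β, (#{b | ∀ i, Γ (a i) b} : ℝ) ^ s := by
    rw [← hcardF]
    refine card_mul_pow_le_sum_pow (fun a : Fin s → β => (#{b | ∀ i, Γ (a i) b} : ℝ))
      (fun _ => by positivity) (by positivity) ?_ s
    rw [hcardF]
    calc c ^ s * N * N ^ s = (c * N) ^ s * N := by rw [mul_pow]; ring
      _ ≤ _ := h1
      _ = _ := by exact_mod_cast h2.symm
  have h4 : ∑ a : Fin s → β, #{b | ∀ i, Γ (a i) b} ^ s =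
      #{q : (Fin s → β) × (Fin s → β) | ∀ j i, Γ (q.1 i) (q.2 j)} := by
    rw [← sum_card_filter_eq_card_filter_prod
      (fun a b : Fin s → β => ∀ j i, Γ (a i) (b j))]
    refine sum_congr rfl fun a _ => ?_
    rw [← card_filter_forall_fin]
  have e1 : (c ^ s * N) ^ s * (N ^ s) = c ^ (s * s) * (N ^ s * N ^ s) := by
    rw [mul_pow, pow_mul]; ring
  rw [← e1]
  refine h3.trans (le_of_eq ?_)
  exact_mod_cast h4

/-- A dense relation `Γ` on a finite type contains a complete bipartite relation `K_{s,s}` both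
sides of which are independent with respect to a given sufficiently sparse relation `Z`. -/
lemma exists_biclique_of_dense (Γ Z : β → β → Prop) [∀ a b, Decidable (Γ a b)]
    [∀ a b, Decidable (Z a b)] (s : ℕ) {c ε : ℝ} (hc : 0 ≤ c) (hβ : 0 < Fintype.card β)
    (hΓ : c * (Fintype.card β : ℝ) ^ 2 ≤ #{q : β × β | Γ q.1 q.2})
    (hZ : (#{q : β × β | Z q.1 q.2} : ℝ) ≤ ε * (Fintype.card β : ℝ) ^ 2)
    (hεc : 2 * (s : ℝ) ^ 2 * ε < c ^ (s * s)) :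
    ∃ a b : Fin s → β, (∀ i j, Γ (a i) (b j)) ∧ (∀ i j, i ≠ j → ¬ Z (a i) (a j)) ∧
      ∀ i j, i ≠ j → ¬ Z (b i) (b j) := by
  classical
  set N : ℝ := (Fintype.card β : ℝ) with hN
  have hN0 : 0 < N := by rw [hN]; exact_mod_cast hβ
  have hcardF : (Fintype.card (Fin s → β) : ℝ) = N ^ s := by simp [hN]
  -- Tuples violating independence. If every biclique had a bad side, their number would be at most
  -- `2 * #bad * N ^ s`, which `hεc` makes too small.
  set bad : Finset (Fin s → β) := {a | ∃ i j, i ≠ j ∧ Z (a i) (a j)} with hbad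
  have hbadcard : (#bad : ℝ) ≤ (s : ℝ) ^ 2 * ε * N ^ s := by
    have hsub : bad ⊆ (univ.filter fun q : Fin s × Fin s => q.1 ≠ q.2).biUnion
        fun q => {a : Fin s → β | Z (a q.1) (a q.2)} := by
      intro a ha
      simp only [hbad, mem_filter, mem_univ, true_and] at ha
      obtain ⟨i, j, hij, hz⟩ := ha
      simp only [mem_biUnion, mem_filter, mem_univ, true_and]
      exact ⟨(i, j), hij, hz⟩
    have hterm : ∀ q ∈ univ.filter (fun q : Fin s × Fin s => q.1 ≠ q.2),
        (#{a : Fin s → β | Z (a q.1) (a q.2)} : ℝ) ≤ ε * N ^ s := by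
      intro q hq
      have h := card_filter_pair_le s Z (mem_filter.1 hq).2
      have h' : (#{a : Fin s → β | Z (a q.1) (a q.2)} : ℝ) * N ^ 2 ≤
          #{q : β × β | Z q.1 q.2} * N ^ s := by rw [hN]; exact_mod_cast h
      have h'' := h'.trans (mul_le_mul_of_nonneg_right hZ (by positivity))
      have : (0 : ℝ) < N ^ 2 := by positivity
      nlinarith
    have hε : 0 ≤ ε := by
      have : (0 : ℝ) ≤ ε * N ^ 2 := le_trans (by positivity) hZ
      exact nonneg_of_mul_nonneg_left this (by positivity)
    calc (#bad : ℝ) ≤ ∑ q ∈ univ.filter (fun q : Fin s × Fin s => q.1 ≠ q.2),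
          (#{a : Fin s → β | Z (a q.1) (a q.2)} : ℝ) := by
          exact_mod_cast (card_le_card hsub).trans card_biUnion_le
      _ ≤ #(univ.filter (fun q : Fin s × Fin s => q.1 ≠ q.2)) * (ε * N ^ s) := by
          rw [← nsmul_eq_mul]; exact sum_le_card_nsmul _ _ _ hterm
      _ ≤ (s : ℝ) ^ 2 * (ε * N ^ s) := by
          refine mul_le_mul_of_nonneg_right ?_ (by positivity)
          have := card_filter_le (univ : Finset (Fin s × Fin s)) (fun q => q.1 ≠ q.2)
          simp only [card_univ, Fintype.card_prod, Fintype.card_fin] at this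
          rw [sq]
          exact_mod_cast this
      _ = _ := by ring
  by_contra hcon
  push Not at hcon
  have hsub : ({q : (Fin s → β) × (Fin s → β) | ∀ j i, Γ (q.1 i) (q.2 j)} : Finset _) ⊆
      bad ×ˢ univ ∪ univ ×ˢ bad := by
    rintro ⟨a, b⟩ hab
    simp only [mem_filter, mem_univ, true_and] at hab
    simp only [mem_union, mem_product, mem_univ, true_and, and_true, hbad, mem_filter]
    by_contra! hno
    obtain ⟨i, j, hij, hz⟩ := hcon a b (fun i j => hab j i) hno.1
    exact hno.2 i j hij hz
  have hle := (card_le_card hsub).trans (card_union_le _ _)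
  rw [card_product, card_product, card_univ] at hle
  have hle' : (#{q : (Fin s → β) × (Fin s → β) | ∀ j i, Γ (q.1 i) (q.2 j)} : ℝ) ≤
      #bad * N ^ s + N ^ s * #bad := by
    rw [← hcardF]; exact_mod_cast hle
  have hge := pow_mul_le_card_bicliques Γ s hc hβ hΓ
  rw [← hN] at hge
  have hpos : (0 : ℝ) < N ^ s * N ^ s := by positivity
  have e2 := mul_le_mul_of_nonneg_right hbadcard (by positivity : (0 : ℝ) ≤ N ^ s)
  have e3 := mul_lt_mul_of_pos_right hεc hpos
  nlinarith

end DenseRelation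

/-! ### The pairing strategy -/

section PairingStrategy

lemma toMove_succ_of_ne_maker {first : Player} {m : ℕ} (h : toMove first m ≠ .maker) :
    toMove first (m + 1) = .maker := by
  unfold toMove at *
  rcases Nat.even_or_odd m with hm | hm
  · have h2 : ¬ Even (m + 1) := Nat.not_even_iff_odd.2 hm.add_one
    cases first <;> simp_all [Player.other]
  · have h1 : ¬ Even m := Nat.not_even_iff_odd.2 hm
    have h2 : Even (m + 1) := hm.add_one
    cases first <;> simp_all [Player.other]

variable {β : Type*}

/-- The element `y` is a legal answer to the history `h` which completes, together with the last
element of `h`, a pair related by `r`. -/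
def IsPairingAnswer (r : β → β → Prop) (X : Finset β) (h : List β) (y : β) : Prop :=
  y ∈ X ∧ y ∉ h ∧ ∃ x, h.getLast? = some x ∧ r x y

open Classical in
/-- The strategy that answers the last move by its partner with respect to the relation `r`
whenever this is possible. -/
noncomputable def pairingStrategy (r : β → β → Prop) (X : Finset β) : Strategy X where
  next h :=
    if H : ∃ y, IsPairingAnswer r X h y then some H.choose
    else if H : ∃ y ∈ X, y ∉ h then some H.choose
    else none
  legal h _ _ hex := by
    by_cases H : ∃ y, IsPairingAnswer r X h y
    · exact ⟨H.choose, H.choose_spec.1, H.choose_spec.2.1, by simp only [H, dif_pos]⟩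
    · refine ⟨hex.choose, hex.choose_spec.1, hex.choose_spec.2, ?_⟩
      rw [dif_neg H, dif_pos hex]

lemma pairingStrategy_next {r : β → β → Prop} (hr : ∀ x y z, r x y → r x z → y = z)
    {X : Finset β} {h : List β} {x y : β} (hx : h.getLast? = some x) (hxy : r x y)
    (hyX : y ∈ X) (hy : y ∉ h) : (pairingStrategy r X).next h = some y := by
  have H : ∃ y, IsPairingAnswer r X h y := ⟨y, hyX, hy, x, hx, hxy⟩
  obtain ⟨-, -, x', hx', hr'⟩ := H.choose_spec
  have hxx : x' = x := by rw [hx] at hx'; exact (Option.some.inj hx').symm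
  subst hxx
  simp only [pairingStrategy, H, dif_pos]
  rw [hr _ _ _ hr' hxy]

/-- If Breaker takes `x`, its partner `y` is still free since its turn `n` comes later, so Maker's
immediate reply is `y`. -/
lemma mem_claimed_or_mem_claimed_of_pairingStrategy {r : β → β → Prop}
    (hr : ∀ x y z, r x y → r x z → y = z) {X : Finset β} {first : Player} {l : List β}
    (hl : IsPlay X l) (hf : FollowedBy (pairingStrategy r X) first .maker l) {x y : β}
    {m n : ℕ} (hxy : r x y) (hm : l[m]? = some x) (hn : l[n]? = some y) (hmn : m < n) :
    x ∈ claimed first .maker l ∨ y ∈ claimed first .maker l := by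
  by_cases hmv : toMove first m = .maker
  · exact Or.inl ⟨m, hmv, hm⟩
  refine Or.inr ⟨m + 1, toMove_succ_of_ne_maker hmv, ?_⟩
  have hnl : n < l.length := (List.getElem?_eq_some_iff.1 hn).1
  have hml : m < l.length := hmn.trans hnl
  rw [hf (m + 1) (by omega) (toMove_succ_of_ne_maker hmv)]
  refine pairingStrategy_next hr (x := x) ?_ hxy ((hl.2 y).1 (List.mem_of_getElem? hn)) ?_
  · rw [List.getLast?_eq_getElem?, List.length_take, Nat.min_eq_left (by omega),
      Nat.add_sub_cancel, List.getElem?_take_of_lt (by omega), hm]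
  · intro hy
    obtain ⟨k, hk, hky⟩ := List.mem_iff_getElem.1 hy
    rw [List.length_take, Nat.min_eq_left (by omega)] at hk
    rw [List.getElem_take] at hky
    have hny := (List.getElem?_eq_some_iff.1 hn).2
    have := (hl.1.getElem_inj_iff (hi := by omega) (hj := hnl)).1 (hky.trans hny.symm)
    omega

/-- Maker can claim an element of each pair `{a i, b i}` of a family of disjoint pairs. -/
lemma makerWins_of_disjoint_pairs (first : Player) {X : Finset β} {𝓕 : Set (Set β)} {ι : Type*}
    {a b : ι → β} (hab : Function.Injective (Sum.elim a b)) (ha : ∀ i, a i ∈ X)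
    (hb : ∀ i, b i ∈ X)
    (hwin : ∀ C : Set β, C ⊆ X → (∀ i, a i ∈ C ∨ b i ∈ C) → ∃ F ∈ 𝓕, F ⊆ C) :
    MakerWins first X 𝓕 := by
  -- Each element is related to its partner in both directions; disjointness of the pairs makes `r`
  -- a partial function.
  set r : β → β → Prop := fun x y => ∃ i, (x = a i ∧ y = b i) ∨ (x = b i ∧ y = a i) with hr
  have haa : ∀ i j, a i = a j → i = j := fun i j h => Sum.inl_injective (hab (a₁ := .inl i)
    (a₂ := .inl j) h)
  have hbb : ∀ i j, b i = b j → i = j := fun i j h => Sum.inr_injective (hab (a₁ := .inr i)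
    (a₂ := .inr j) h)
  have hne : ∀ i j, a i ≠ b j := fun i j h => by
    simpa using hab (a₁ := .inl i) (a₂ := .inr j) h
  have hfun : ∀ x y z, r x y → r x z → y = z := by
    rintro x y z ⟨i, ⟨hi, rfl⟩ | ⟨hi, rfl⟩⟩ ⟨j, ⟨hj, rfl⟩ | ⟨hj, rfl⟩⟩
    · rw [haa i j (hi.symm.trans hj)]
    · exact absurd (hi.symm.trans hj) (hne i j)
    · exact absurd (hj.symm.trans hi) (hne j i)
    · rw [hbb i j (hi.symm.trans hj)]
  refine ⟨pairingStrategy r X, fun l hl hf => hwin _ ?_ fun i => ?_⟩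
  · rintro x ⟨k, -, hk⟩
    exact (hl.2 x).1 (List.mem_of_getElem? hk)
  · obtain ⟨m, hm⟩ := List.mem_iff_getElem?.1 ((hl.2 _).2 (ha i))
    obtain ⟨n, hn⟩ := List.mem_iff_getElem?.1 ((hl.2 _).2 (hb i))
    rcases lt_trichotomy m n with h | rfl | h
    · exact mem_claimed_or_mem_claimed_of_pairingStrategy hfun hl hf ⟨i, .inl ⟨rfl, rfl⟩⟩ hm hn h
    · exact absurd (Option.some.inj (hm.symm.trans hn)) (hne i i)
    · exact (mem_claimed_or_mem_claimed_of_pairingStrategy hfun hl hf ⟨i, .inr ⟨rfl, rfl⟩⟩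
        hn hm h).symm

end PairingStrategy

/-! ### Maker's win on two joined matchings -/

section Book

variable {V : Type*}

/-- Only the page vertices need an injectivity assumption: any other two vertices of the book are
adjacent, and ends of an edge are distinct. -/
lemma exists_book_subset {t : ℕ} {G : SimpleGraph V} {C : Set (Sym2 V)} (hC : C ⊆ G.edgeSet)
    {u v : V} {w : Fin t → V} (hw : Function.Injective w) (huv : s(u, v) ∈ C)
    (hu : ∀ i, s(u, w i) ∈ C) (hv : ∀ i, s(v, w i) ∈ C) :
    ∃ F ∈ copyEdgeSets (bookGraph t) G, F ⊆ C := by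
  set f : Fin 2 ⊕ Fin t → V := Sum.elim ![u, v] w with hf
  have hadj : ∀ x y, (bookGraph t).Adj x y → s(f x, f y) ∈ C := by
    intro x y h
    rw [bookGraph, SimpleGraph.fromRel_adj] at h
    rcases x with x | x <;> rcases y with y | y
    · fin_cases x <;> fin_cases y <;> simp_all [Sym2.eq_swap]
    · fin_cases x <;> simp [hf, hu, hv]
    · fin_cases y <;> simp [hf, hu, hv, Sym2.eq_swap (a := w _)]
    · simp at h
  have hne : ∀ x y, s(x, y) ∈ C → x ≠ y := fun x y h => (hC h : G.Adj x y).ne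
  have hinj : Function.Injective f := by
    intro x y hxy
    by_contra hxyne
    by_cases h : (bookGraph t).Adj x y
    · exact hne _ _ (hadj x y h) hxy
    · rw [bookGraph, SimpleGraph.fromRel_adj] at h
      rcases x with x | x <;> rcases y with y | y <;> simp_all
      exact hxyne (hw hxy)
  refine ⟨_, ⟨⟨⟨f, fun {x y} h => hC (hadj x y h)⟩, hinj⟩, rfl⟩, ?_⟩
  rintro _ ⟨e, he, rfl⟩
  induction e using Sym2.ind with
  | h x y => exact hadj x y he

/-- Otherwise every row has at most `t` entries in `A` and every column at most `t` in `B`, whence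
`m * m ≤ 2 * t * m`. -/
lemma exists_row_or_column {t m : ℕ} (hm : 2 * t < m) (A B : Fin m → Fin m → Prop)
    (h : ∀ i j, A i j ∨ B i j) :
    (∃ i, ∃ g : Fin t → Fin m, Function.Injective g ∧ ∀ r, A i (g r)) ∨
      ∃ j, ∃ g : Fin t → Fin m, Function.Injective g ∧ ∀ r, B (g r) j := by
  classical
  have hex : ∀ p : Fin m → Prop, t ≤ (Finset.univ.filter p).card →
      ∃ g : Fin t → Fin m, Function.Injective g ∧ ∀ r, p (g r) := by
    intro p hp
    obtain ⟨s, hs, hcard⟩ := Finset.exists_subset_card_eq hp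
    refine ⟨fun r => s.orderEmbOfFin hcard r, (s.orderEmbOfFin hcard).injective, fun r => ?_⟩
    exact (Finset.mem_filter.1 (hs (s.orderEmbOfFin_mem hcard r))).2
  by_contra! hcon
  have hA : ∀ i, (Finset.univ.filter (A i)).card ≤ t := fun i => by
    by_contra! hi
    obtain ⟨g, hg, hg'⟩ := hex _ hi.le
    obtain ⟨r, hr⟩ := hcon.1 i g hg
    exact hr (hg' r)
  have hB : ∀ j, (Finset.univ.filter fun i => B i j).card ≤ t := fun j => by
    by_contra! hj
    obtain ⟨g, hg, hg'⟩ := hex _ hj.le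
    obtain ⟨r, hr⟩ := hcon.2 j g hg
    exact hr (hg' r)
  have hcover : (Finset.univ : Finset (Fin m × Fin m)).card ≤
      (Finset.univ.filter fun q : Fin m × Fin m => A q.1 q.2).card +
        (Finset.univ.filter fun q : Fin m × Fin m => B q.1 q.2).card := by
    refine (Finset.card_le_card fun q _ => ?_).trans (Finset.card_union_le _ _)
    simpa using h q.1 q.2
  rw [← sum_card_filter_eq_card_filter_prod A, ← sum_card_filter_eq_card_filter_prod B] at hcover
  have hBs : ∑ i, (Finset.univ.filter fun j => B i j).card =
      ∑ j, (Finset.univ.filter fun i => B i j).card :=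
    Finset.sum_card_bipartiteAbove_eq_sum_card_bipartiteBelow B
  have h1 := Finset.sum_le_card_nsmul Finset.univ _ t fun i _ => hA i
  have h2 := Finset.sum_le_card_nsmul Finset.univ _ t fun j _ => hB j
  simp only [Finset.card_univ, Fintype.card_prod, Fintype.card_fin, smul_eq_mul] at hcover h1 h2
  have : m * (2 * t) < m * m := Nat.mul_lt_mul_of_pos_left hm (by omega)
  nlinarith

/-- If two families of disjoint edges are completely joined to each other, then Maker
can claim a book. -/
lemma makerWinsGraphGame_book [Fintype V] (first : Player) {t m : ℕ} (hm : 2 * t < m)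
    {G : SimpleGraph V} {U W : (Fin m × Bool) × Bool → V} (hU : Function.Injective U)
    (hW : Function.Injective W) (hUU : ∀ k, G.Adj (U (k, false)) (U (k, true)))
    (hWW : ∀ k, G.Adj (W (k, false)) (W (k, true))) (hUW : ∀ x y, G.Adj (U x) (W y)) :
    MakerWinsGraphGame first (bookGraph t) G := by
  classical
  have hd : ∀ x y, U x ≠ W y := fun x y => (hUW x y).ne
  have hd' : ∀ x y, W y ≠ U x := fun x y => (hUW x y).ne'
  set e : Fin m × Bool → Sym2 V := fun k => s(U (k, false), U (k, true)) with he
  set f : Fin m × Bool → Sym2 V := fun k => s(W (k, false), W (k, true)) with hf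
  -- The pairs: two edges of the same group on the `U` side, likewise on the `W` side, and opposite
  -- edges in the K_{2,2} between a `U`-edge and a `W`-edge.
  let a : Fin m ⊕ Fin m ⊕ ((Fin m × Bool) × (Fin m × Bool)) × Bool → Sym2 V :=
    Sum.elim (fun i => e (i, false)) (Sum.elim (fun j => f (j, false))
      fun q => s(U (q.1.1, false), W (q.1.2, q.2)))
  let b : Fin m ⊕ Fin m ⊕ ((Fin m × Bool) × (Fin m × Bool)) × Bool → Sym2 V :=
    Sum.elim (fun i => e (i, true)) (Sum.elim (fun j => f (j, true))
      fun q => s(U (q.1.1, true), W (q.1.2, !q.2)))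
  refine makerWins_of_disjoint_pairs first (a := a) (b := b) ?_ ?_ ?_ ?_
  · rintro ((i | j | ⟨⟨k, l⟩, c⟩) | (i | j | ⟨⟨k, l⟩, c⟩))
      ((i' | j' | ⟨⟨k', l'⟩, c'⟩) | (i' | j' | ⟨⟨k', l'⟩, c'⟩)) h <;>
    simp [a, b, he, hf, hU.eq_iff, hW.eq_iff, hd, hd'] at h ⊢ <;> simp_all
  · rintro (i | j | q) <;> simp [a, he, hf, hUU, hWW, hUW]
  · rintro (i | j | q) <;> simp [b, he, hf, hUU, hWW, hUW]
  · intro C hCG hC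
    have hCG' : C ⊆ G.edgeSet := by simpa using hCG
    have hσ : ∀ i : Fin m, ∃ c, e (i, c) ∈ C := fun i =>
      (hC (.inl i)).elim (fun h => ⟨_, h⟩) fun h => ⟨_, h⟩
    have hτ : ∀ j : Fin m, ∃ c, f (j, c) ∈ C := fun j =>
      (hC (.inr (.inl j))).elim (fun h => ⟨_, h⟩) fun h => ⟨_, h⟩
    choose σ hσ using hσ
    choose τ hτ using hτ
    -- One edge from each diagonal of a 4-cycle: the two chosen edges always share a vertex, on
    -- either the `W` side or the `U` side.
    have hcross : ∀ k l,
        (∃ c, s(U (k, false), W (l, c)) ∈ C ∧ s(U (k, true), W (l, c)) ∈ C) ∨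
        ∃ c, s(W (l, false), U (k, c)) ∈ C ∧ s(W (l, true), U (k, c)) ∈ C := by
      intro k l
      have h1 : s(U (k, false), W (l, false)) ∈ C ∨ s(U (k, true), W (l, true)) ∈ C :=
        hC (.inr (.inr ((k, l), false)))
      have h2 : s(U (k, false), W (l, true)) ∈ C ∨ s(U (k, true), W (l, false)) ∈ C :=
        hC (.inr (.inr ((k, l), true)))
      simp only [Sym2.eq_swap (a := W _)]
      rcases h1 with h1 | h1 <;> rcases h2 with h2 | h2
      · exact .inr ⟨false, h1, h2⟩
      · exact .inl ⟨false, h1, h2⟩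
      · exact .inl ⟨true, h2, h1⟩
      · exact .inr ⟨true, h2, h1⟩
    rcases exists_row_or_column hm _ _ fun i j => hcross (i, σ i) (j, τ j) with
      ⟨i, g, hg, h⟩ | ⟨j, g, hg, h⟩
    · choose c hc using h
      refine exists_book_subset hCG' (w := fun r => W ((g r, τ (g r)), c r)) ?_ (hσ i)
        (fun r => (hc r).1) fun r => (hc r).2
      intro r r' hr
      have := hW hr
      simp only [Prod.mk.injEq] at this
      exact hg this.1.1
    · choose c hc using h
      refine exists_book_subset hCG' (w := fun r => U ((g r, σ (g r)), c r)) ?_ (hτ j)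
        (fun r => (hc r).1) fun r => (hc r).2
      intro r r' hr
      have := hU hr
      simp only [Prod.mk.injEq] at this
      exact hg this.1.1

end Book

/-! ### Counting joined and intersecting pairs of edges -/

section GraphCounting

open Finset

variable {V : Type*}

/-- Two pairs of vertices are completely joined in `G`. -/
def CompletelyJoined (G : SimpleGraph V) (e f : Sym2 V) : Prop :=
  ∀ u ∈ e, ∀ x ∈ f, G.Adj u x

/-- Two pairs of vertices have a vertex in common. -/
def ShareVertex (e f : Sym2 V) : Prop :=
  ∃ v, v ∈ e ∧ v ∈ f

lemma exists_injective_endpoints {κ : Type*} {R : SimpleGraph V} {e : κ → Sym2 V}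
    (he : ∀ k, e k ∈ R.edgeSet) (hdisj : ∀ k l, k ≠ l → ¬ ShareVertex (e k) (e l)) :
    ∃ U : κ × Bool → V, Function.Injective U ∧ ∀ k, s(U (k, false), U (k, true)) = e k := by
  have h : ∀ k, ∃ u v, s(u, v) = e k := fun k => by
    induction e k using Sym2.ind with
    | h u v => exact ⟨u, v, rfl⟩
  choose u v huv using h
  have hne : ∀ k, u k ≠ v k := fun k => by
    have := he k
    rw [← huv k, SimpleGraph.mem_edgeSet] at this
    exact this.ne
  have hmem : ∀ k c, cond c (v k) (u k) ∈ e k := fun k c => by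
    rw [← huv k]; cases c <;> simp
  refine ⟨fun q => cond q.2 (v q.1) (u q.1), ?_, huv⟩
  rintro ⟨k, c⟩ ⟨l, d⟩ h
  have hkl : k = l := by
    by_contra hkl
    have hd := hmem l d
    simp only at h
    rw [← h] at hd
    exact hdisj k l hkl ⟨_, hmem k c, hd⟩
  subst hkl
  have := hne k
  cases c <;> cases d <;> simp_all [eq_comm]

variable [Fintype V] [DecidableEq V]

open Classical in
/-- The pairs of edges of the complete graph on `V` that are related by `r`. -/
noncomputable def edgePairs (r : Sym2 V → Sym2 V → Prop) : Finset (Sym2 V × Sym2 V) :=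
  ((⊤ : SimpleGraph V).edgeFinset ×ˢ (⊤ : SimpleGraph V).edgeFinset).filter fun q => r q.1 q.2

open Classical in
lemma pairCount_edgePairs (r : Sym2 V → Sym2 V → Prop) {T : Finset (Sym2 V)}
    (hT : T ⊆ (⊤ : SimpleGraph V).edgeFinset) :
    pairCount (edgePairs r) T = #{q : T × T | r q.1 q.2} := by
  rw [pairCount, sum_boole]
  congr 1
  symm
  refine card_bij (fun q _ => ((q.1 : Sym2 V), (q.2 : Sym2 V))) ?_ ?_ ?_
  · rintro ⟨⟨e, he⟩, ⟨f, hf⟩⟩ h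
    simp only [mem_filter, mem_univ, true_and] at h
    simp only [edgePairs, mem_filter, mem_product, insert_subset_iff, singleton_subset_iff]
    exact ⟨⟨⟨hT he, hT hf⟩, h⟩, he, hf⟩
  · rintro ⟨e, f⟩ - ⟨e', f'⟩ - h
    simp only [Prod.mk.injEq] at h
    exact Prod.ext (Subtype.ext h.1) (Subtype.ext h.2)
  · rintro ⟨e, f⟩ h
    simp only [edgePairs, mem_filter, mem_product, insert_subset_iff, singleton_subset_iff] at h
    exact ⟨(⟨e, h.2.1⟩, ⟨f, h.2.2⟩), by simpa using h.1.2, rfl⟩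

lemma card_filter_mk_eq_le_two (e : Sym2 V) :
    #{a : Fin 2 → V | s(a 0, a 1) = e} ≤ 2 := by
  induction e using Sym2.ind with
  | h u v =>
    refine (card_le_card (t := {![u, v], ![v, u]}) fun a ha => ?_).trans card_le_two
    simp only [mem_filter, mem_univ, true_and, Sym2.eq_iff] at ha
    simp only [mem_insert, mem_singleton]
    refine ha.imp ?_ ?_ <;> rintro ⟨h0, h1⟩ <;> funext i <;> fin_cases i <;> simp [h0, h1]

lemma card_filter_apply_zero_eq_le : #{a : Fin 2 → V | a 0 = a 1} ≤ Fintype.card V := by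
  refine card_le_card_of_injOn (fun a => a 0) (fun _ _ => mem_univ _) ?_
  intro a ha b hb h
  simp only [coe_filter, mem_univ, true_and, Set.mem_ofPred_eq] at ha hb
  funext i
  fin_cases i
  · exact h
  · exact ha.symm.trans (Eq.trans h hb)

/-- The biclique count with `s = 2`. At most `2n³` homomorphisms of K_{2,2} identify the two
vertices of a side, and each pair of edges arises from at most four of the others, by ordering the
ends. -/
lemma pow_mul_le_card_edgePairs_completelyJoined (G : SimpleGraph V) [DecidableRel G.Adj]
    {α : ℝ} (hα : 0 ≤ α) (hV : 0 < Fintype.card V)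
    (hG : α * Fintype.card V ≤ G.minDegree) :
    α ^ 4 * (Fintype.card V : ℝ) ^ 4 - 2 * (Fintype.card V : ℝ) ^ 3 ≤
      4 * #(edgePairs (CompletelyJoined G)) := by
  classical
  set n := Fintype.card V with hn
  have hdens : α * (n : ℝ) ^ 2 ≤ #{q : V × V | G.Adj q.1 q.2} := by
    rw [← sum_card_filter_eq_card_filter_prod G.Adj]
    have : ∀ v ∈ (univ : Finset V), α * n ≤ (#{w | G.Adj v w} : ℝ) := fun v _ => by
      refine hG.trans ?_
      rw [← SimpleGraph.neighborFinset_eq_filter, SimpleGraph.card_neighborFinset_eq_degree]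
      exact_mod_cast G.minDegree_le_degree v
    have h := card_nsmul_le_sum _ _ _ this
    rw [card_univ, nsmul_eq_mul, ← hn] at h
    push_cast
    linarith
  have hcount := pow_mul_le_card_bicliques G.Adj 2 hα hV hdens
  set S : Finset ((Fin 2 → V) × (Fin 2 → V)) :=
    {q | ∀ j i, G.Adj (q.1 i) (q.2 j)} with hS
  set D : Finset (Fin 2 → V) := {a | a 0 = a 1} with hD
  have hsplit : #S ≤ #(S.filter fun q => q.1 ∉ D ∧ q.2 ∉ D) + (n * n ^ 2 + n ^ 2 * n) := by
    have hsub : S ⊆ (S.filter fun q => q.1 ∉ D ∧ q.2 ∉ D) ∪ (D ×ˢ univ ∪ univ ×ˢ D) := by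
      intro q hq
      simp only [mem_union, mem_filter, mem_product, mem_univ, true_and, and_true, hq]
      tauto
    refine (card_le_card hsub).trans ((card_union_le _ _).trans (Nat.add_le_add_left
      ((card_union_le _ _).trans ?_) _))
    simp only [card_product, card_univ, Fintype.card_fun, Fintype.card_fin]
    exact add_le_add (Nat.mul_le_mul_right _ card_filter_apply_zero_eq_le)
      (Nat.mul_le_mul_left _ card_filter_apply_zero_eq_le)
  have hfib : #(S.filter fun q => q.1 ∉ D ∧ q.2 ∉ D) ≤
      4 * #(edgePairs (CompletelyJoined G)) := by
    refine card_le_mul_card_image_of_maps_to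
      (f := fun q : (Fin 2 → V) × (Fin 2 → V) => (s(q.1 0, q.1 1), s(q.2 0, q.2 1))) ?_ 4 ?_
    · rintro ⟨a, b⟩ h
      simp only [hS, hD, mem_filter, mem_univ, true_and] at h
      simp only [edgePairs, mem_filter, mem_product, SimpleGraph.mem_edgeFinset,
        SimpleGraph.mem_edgeSet, SimpleGraph.top_adj]
      refine ⟨h.2, ?_⟩
      intro u hu x hx
      rw [Sym2.mem_iff] at hu hx
      rcases hu with rfl | rfl <;> rcases hx with rfl | rfl <;> exact h.1 _ _
    · rintro ⟨e, f⟩ -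
      refine (card_le_card (t := ({a : Fin 2 → V | s(a 0, a 1) = e} : Finset _) ×ˢ
        ({a : Fin 2 → V | s(a 0, a 1) = f} : Finset _)) ?_).trans ?_
      · rintro ⟨a, b⟩ h
        simp only [mem_filter, Prod.mk.injEq] at h
        simpa using h.2
      · rw [card_product]
        exact Nat.mul_le_mul (card_filter_mk_eq_le_two e) (card_filter_mk_eq_le_two f)
  have h : (#S : ℝ) ≤ 4 * #(edgePairs (CompletelyJoined G)) + (n * n ^ 2 + n ^ 2 * n) := by
    exact_mod_cast hsplit.trans (Nat.add_le_add_right hfib _)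
  norm_num at hcount
  linarith

/-- Such a pair is determined by the common vertex and the two other ends. -/
lemma card_edgePairs_shareVertex_le :
    #(edgePairs (ShareVertex (V := V))) ≤ Fintype.card V ^ 3 := by
  classical
  refine (card_le_card (t := (univ : Finset (V × V × V)).image
    fun w => (s(w.1, w.2.1), s(w.1, w.2.2))) ?_).trans (card_image_le.trans (le_of_eq ?_))
  · rintro ⟨e, f⟩ h
    obtain ⟨v, ⟨x, rfl⟩, ⟨y, rfl⟩⟩ := (mem_filter.1 h).2
    exact mem_image.2 ⟨(v, x, y), mem_univ _, rfl⟩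
  · simp only [card_univ, Fintype.card_prod]
    ring

end GraphCounting

/-! ### From pair counts to Maker's win -/

section Typical

open Finset

variable {V : Type*} [Fintype V] [DecidableEq V]

/-- Maker wins the game for books if the graph `G` is dense and the sparse graph `R` spans about
as many pairs of edges of the relevant kinds as expected. -/
lemma makerWinsGraphGame_sup_of_pairCount (first : Player) (t : ℕ) (G R : SimpleGraph V)
    {T : Finset (Sym2 V)} (hT : ∀ e, e ∈ T ↔ e ∈ R.edgeSet) {c ε : ℝ} (hc : 0 ≤ c)
    (hT0 : 0 < #T) (hεc : 2 * ((2 * (2 * t + 1) : ℕ) : ℝ) ^ 2 * ε <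
      c ^ ((2 * (2 * t + 1)) * (2 * (2 * t + 1))))
    (hΓ : c * (#T : ℝ) ^ 2 ≤ pairCount (edgePairs (CompletelyJoined G)) T)
    (hZ : pairCount (edgePairs ShareVertex) T ≤ ε * (#T : ℝ) ^ 2) :
    MakerWinsGraphGame first (bookGraph t) (G ⊔ R) := by
  classical
  have hTtop : T ⊆ (⊤ : SimpleGraph V).edgeFinset := fun e he => by
    rw [SimpleGraph.mem_edgeFinset]
    exact SimpleGraph.edgeSet_mono le_top ((hT e).1 he)
  rw [pairCount_edgePairs _ hTtop] at hΓ hZ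
  obtain ⟨a, b, hab, ha, hb⟩ := exists_biclique_of_dense (β := T)
    (fun e f => CompletelyJoined G e f) (fun e f => ShareVertex (e : Sym2 V) f)
    (2 * (2 * t + 1)) hc (by simpa using hT0) (by simpa using hΓ) (by simpa using hZ) hεc
  -- Splits the edges of each side into `2 * t + 1` groups of two.
  let φ : Fin (2 * t + 1) × Bool ≃ Fin (2 * (2 * t + 1)) :=
    Fintype.equivFinOfCardEq (by simp [mul_comm])
  obtain ⟨U, hU, hUe⟩ := exists_injective_endpoints (R := R)
    (e := fun k => (a (φ k) : Sym2 V)) (fun k => (hT _).1 (a (φ k)).2)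
    fun k l hkl => ha _ _ (φ.injective.ne hkl)
  obtain ⟨W, hW, hWe⟩ := exists_injective_endpoints (R := R)
    (e := fun k => (b (φ k) : Sym2 V)) (fun k => (hT _).1 (b (φ k)).2)
    fun k l hkl => hb _ _ (φ.injective.ne hkl)
  refine makerWinsGraphGame_book first (t := t) (m := 2 * t + 1) (by omega) hU hW ?_ ?_ ?_
  · intro k
    refine Or.inr ?_
    rw [← SimpleGraph.mem_edgeSet, hUe]
    exact (hT _).1 (a (φ k)).2
  · intro k
    refine Or.inr ?_
    rw [← SimpleGraph.mem_edgeSet, hWe]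
    exact (hT _).1 (b (φ k)).2
  · rintro ⟨k, c⟩ ⟨l, d⟩
    refine Or.inl (hab (φ k) (φ l) _ ?_ _ ?_)
    · rw [← hUe]; cases c <;> simp
    · rw [← hWe]; cases d <;> simp

end Typical

/-! ### Probability that Maker fails -/

section Probability

open Finset
open scoped ENNReal

variable {V : Type*} [Fintype V] [DecidableEq V]

-- Passes from the measure on graphs to the finite sum over edge sets; an upper bound is enough,
-- since only failure is estimated.
open Classical in
lemma binomialRandom_le_bernoulliExp (p : unitInterval) (A : Finset (Sym2 V) → Prop) :
    SimpleGraph.binomialRandom V p {R | A R.edgeFinset} ≤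
      ENNReal.ofReal (bernoulliExp (p : ℝ) (⊤ : SimpleGraph V).edgeFinset
        fun T => if A T then 1 else 0) := by
  have hp0 : (0 : ℝ) ≤ p := p.2.1
  have hp1 : (0 : ℝ) ≤ 1 - p := sub_nonneg.2 p.2.2
  have hN : #(⊤ : SimpleGraph V).edgeFinset = (Fintype.card V).choose 2 :=
    SimpleGraph.card_edgeFinset_top_eq_card_choose_two
  set w : Finset (Sym2 V) → ℝ := fun T =>
    (p : ℝ) ^ #T * (1 - p) ^ (#(⊤ : SimpleGraph V).edgeFinset - #T) with hw
  have hw0 : ∀ T, 0 ≤ w T := fun T => by positivity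
  have hcoe : {R : SimpleGraph V | A R.edgeFinset} =
      ⋃ R ∈ (univ.filter fun R : SimpleGraph V => A R.edgeFinset), {R} := by
    ext R; simp
  have hsingle : ∀ R : SimpleGraph V, SimpleGraph.binomialRandom V p {R} =
      ENNReal.ofReal (w R.edgeFinset) := fun R => by
    rw [SimpleGraph.binomialRandom_singleton, hw]
    simp only
    rw [ENNReal.ofReal_mul (by positivity), ENNReal.ofReal_pow hp0, ENNReal.ofReal_pow hp1, hN,
      Nat.card_eq_fintype_card, ← SimpleGraph.coe_edgeFinset, Set.ncard_coe_finset,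
      ENNReal.ofReal_eq_coe_nnreal hp0, ENNReal.ofReal_eq_coe_nnreal hp1]
    rfl
  calc _ ≤ ∑ R ∈ univ.filter (fun R : SimpleGraph V => A R.edgeFinset),
        SimpleGraph.binomialRandom V p {R} := by
        rw [hcoe]; exact MeasureTheory.measure_biUnion_finset_le _ _
    _ = ENNReal.ofReal (∑ R ∈ univ.filter (fun R : SimpleGraph V => A R.edgeFinset),
          w R.edgeFinset) := by
        rw [ENNReal.ofReal_sum_of_nonneg fun R _ => hw0 _]
        exact sum_congr rfl fun R _ => hsingle R
    _ ≤ _ := by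
        refine ENNReal.ofReal_le_ofReal ?_
        have himage : ∑ R ∈ univ.filter (fun R : SimpleGraph V => A R.edgeFinset),
            w R.edgeFinset = ∑ T ∈ (univ.filter fun R : SimpleGraph V => A R.edgeFinset).image
              (fun R => R.edgeFinset), w T := by
          rw [sum_image]
          intro R _ R' _ h
          exact SimpleGraph.edgeFinset_inj.1 h
        rw [himage, bernoulliExp]
        simp only [mul_ite, mul_one, mul_zero]
        rw [← sum_filter]
        refine sum_le_sum_of_subset_of_nonneg ?_ fun T _ _ => hw0 T
        intro T hT
        obtain ⟨R, hR, rfl⟩ := mem_image.1 hT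
        rw [mem_filter, mem_powerset]
        exact ⟨SimpleGraph.edgeFinset_mono le_top, (mem_filter.1 hR).2⟩

open Classical in
/-- The probability that Maker does not win is small, as soon as the expected number of edges of the
random graph is large and pairs of vertices are completely joined often enough. -/
lemma binomialRandom_not_makerWins_le (first : Player) (t : ℕ) (G : SimpleGraph V)
    (p : unitInterval) {c ε x : ℝ} (hε : 0 < ε) (hε2 : ε ≤ 1 / 2) (hc : 2 * ε ≤ c)
    (hεc : 2 * ((2 * (2 * t + 1) : ℕ) : ℝ) ^ 2 * (4 * ε) <
      (c / 4) ^ ((2 * (2 * t + 1)) * (2 * (2 * t + 1))))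
    (hx : x = #(⊤ : SimpleGraph V).edgeFinset * p) (hx1 : 1 ≤ x)
    (hΓ : c * (#(⊤ : SimpleGraph V).edgeFinset : ℝ) ^ 2 ≤ #(edgePairs (CompletelyJoined G)))
    (hZ : (#(edgePairs (ShareVertex (V := V))) : ℝ) ≤
      ε * (#(⊤ : SimpleGraph V).edgeFinset : ℝ) ^ 2) :
    SimpleGraph.binomialRandom V p {R | ¬ MakerWinsGraphGame first (bookGraph t) (G ⊔ R)} ≤
      ENNReal.ofReal (42 / (ε ^ 2 * x)) := by
  set P := (⊤ : SimpleGraph V).edgeFinset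
  have h0 : (0 : ℝ) ≤ p := p.2.1
  have h1 : (p : ℝ) ≤ 1 := p.2.2
  let dev : Finset (Sym2 V × Sym2 V) → Finset (Sym2 V) → Prop := fun Q T =>
    ε * x ^ 2 < |pairCount Q T - #Q * (p : ℝ) ^ 2|
  set QΓ := edgePairs (CompletelyJoined G)
  set QZ := edgePairs (ShareVertex (V := V))
  -- The pairs in `P ×ˢ P` control `#T ^ 2`, so one deviation bound serves all three events; 42 = 3
  -- * 14.
  let A : Finset (Sym2 V) → Prop := fun T => dev (P ×ˢ P) T ∨ dev QΓ T ∨ dev QZ T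
  have hexp : ∀ Q ⊆ P ×ˢ P,
      bernoulliExp (p : ℝ) P (fun T => if dev Q T then 1 else 0) ≤ 14 / (ε ^ 2 * x) :=
    fun Q hQ => by
      have := bernoulliExp_pairCount_deviation h0 h1 hQ (by rw [← hx]; exact hx1) hε
      rw [← hx] at this
      exact this
  have hsub : {R : SimpleGraph V | ¬ MakerWinsGraphGame first (bookGraph t) (G ⊔ R)} ⊆
      {R | A R.edgeFinset} := by
    intro R hR
    by_contra hA
    refine hR ?_
    simp only [A, dev, Set.mem_ofPred_eq, not_or, not_lt, abs_le] at hA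
    obtain ⟨⟨ha1, ha2⟩, ⟨hb1, -⟩, ⟨-, hc2⟩⟩ := hA
    have hRP : R.edgeFinset ⊆ P := SimpleGraph.edgeFinset_mono le_top
    rw [pairCount_product hRP, card_product] at ha1 ha2
    have hxx : ((#P * #P : ℕ) : ℝ) * (p : ℝ) ^ 2 = x ^ 2 := by rw [hx]; push_cast; ring
    rw [hxx] at ha1 ha2
    have hΓ' : c * x ^ 2 ≤ #QΓ * (p : ℝ) ^ 2 := by
      have := mul_le_mul_of_nonneg_right hΓ (sq_nonneg (p : ℝ))
      rw [hx]; linarith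
    have hZ' : #QZ * (p : ℝ) ^ 2 ≤ ε * x ^ 2 := by
      have := mul_le_mul_of_nonneg_right hZ (sq_nonneg (p : ℝ))
      rw [hx]; linarith
    have hx2 : 0 < x ^ 2 := by positivity
    have hεx : ε * x ^ 2 ≤ 1 / 2 * x ^ 2 := mul_le_mul_of_nonneg_right hε2 hx2.le
    have hcx : 2 * ε * x ^ 2 ≤ c * x ^ 2 := mul_le_mul_of_nonneg_right hc hx2.le
    have hcard0 : 0 < #R.edgeFinset := by
      rcases Nat.eq_zero_or_pos #R.edgeFinset with h | h
      · rw [h] at ha1; norm_num at ha1; linarith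
      · exact h
    -- Off the bad event, `#T ^ 2` lies between `x ^ 2 / 2` and `2 * x ^ 2`, joined pairs number at
    -- least `(c / 2) * x ^ 2` and meeting pairs at most `2 * ε * x ^ 2`; hence the densities `c /
    -- 4` and `4 * ε`.
    refine makerWinsGraphGame_sup_of_pairCount first t G R (T := R.edgeFinset)
      (fun e => SimpleGraph.mem_edgeFinset) (c := c / 4) (by linarith) hcard0 hεc ?_ ?_
    · have : c / 4 * (#R.edgeFinset : ℝ) ^ 2 ≤ c / 4 * (2 * x ^ 2) :=
        mul_le_mul_of_nonneg_left (by linarith) (by linarith)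
      linarith
    · have : 4 * ε * (1 / 2 * x ^ 2) ≤ 4 * ε * (#R.edgeFinset : ℝ) ^ 2 :=
        mul_le_mul_of_nonneg_left (by linarith) (by linarith)
      linarith
  refine (MeasureTheory.measure_mono hsub).trans
    ((binomialRandom_le_bernoulliExp p A).trans (ENNReal.ofReal_le_ofReal ?_))
  have hA : bernoulliExp (p : ℝ) P (fun T => if A T then 1 else 0) ≤
      bernoulliExp (p : ℝ) P (fun T => (if dev (P ×ˢ P) T then 1 else 0) +
        ((if dev QΓ T then 1 else 0) + if dev QZ T then 1 else 0)) := by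
    refine bernoulliExp_mono h0 h1 P fun T _ => ?_
    by_cases d1 : dev (P ×ˢ P) T <;> by_cases d2 : dev QΓ T <;> by_cases d3 : dev QZ T <;>
      simp [A, d1, d2, d3]
  rw [bernoulliExp_add, bernoulliExp_add] at hA
  have e1 := hexp _ subset_rfl
  have e2 := hexp QΓ (filter_subset _ _)
  have e3 := hexp QZ (filter_subset _ _)
  have e4 : 42 / (ε ^ 2 * x) = 14 / (ε ^ 2 * x) + (14 / (ε ^ 2 * x) + 14 / (ε ^ 2 * x)) := by ring
  rw [e4]
  refine le_trans (le_of_eq ?_) (hA.trans (add_le_add e1 (add_le_add e2 e3)))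
  congr!

/-- Uses `n.choose 2 ≥ n ^ 2 / 4` for `n ≥ 2`, which explains the 4 in the constant `1 / (4 * (|K| +
1))`. -/
lemma tendsto_choose_two_mul_atTop {p : ℕ → unitInterval}
    (hp : (fun n : ℕ => (n : ℝ) ^ (-2 : ℤ)) =o[atTop] fun n : ℕ => (p n : ℝ)) :
    Tendsto (fun n : ℕ => (n.choose 2 : ℝ) * p n) atTop atTop := by
  rw [tendsto_atTop]
  intro K
  have hK : (0 : ℝ) < 1 / (4 * (|K| + 1)) := by positivity
  filter_upwards [hp.def hK, eventually_ge_atTop 2] with n hn hn2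
  have hn2' : (2 : ℝ) ≤ n := by exact_mod_cast hn2
  have hp0 : (0 : ℝ) ≤ p n := (p n).2.1
  rw [Real.norm_of_nonneg (by positivity), Real.norm_of_nonneg hp0, zpow_neg,
    show (n : ℝ) ^ (2 : ℤ) = (n : ℝ) ^ 2 from zpow_natCast _ 2, inv_eq_one_div,
    div_le_iff₀ (by positivity), one_div_mul_eq_div, div_mul_eq_mul_div,
    le_div_iff₀ (by positivity)] at hn
  rw [Nat.cast_choose_two]
  have h1 : (n : ℝ) ^ 2 / 4 ≤ n * (n - 1) / 2 := by nlinarith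
  have h2 := mul_le_mul_of_nonneg_right h1 hp0
  have := le_abs_self K
  nlinarith

end Probability

/-! ### Choice of constants and the limit -/

theorem proposition5p2 (t : ℕ) (α : ℝ) (hα : 0 < α)
    (G : ∀ n : ℕ, SimpleGraph (Fin n)) [∀ n, DecidableRel (G n).Adj]
    (hG : ∀ᶠ n : ℕ in atTop, α * (n : ℝ) ≤ ((G n).minDegree : ℝ))
    (p : ℕ → unitInterval)
    (hp : (fun n : ℕ => (n : ℝ) ^ (-2 : ℤ)) =o[atTop] fun n : ℕ => (p n : ℝ))
    (first : Player) :
    Tendsto (fun n : ℕ => SimpleGraph.binomialRandom (Fin n) (p n)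
        {R : SimpleGraph (Fin n) | MakerWinsGraphGame first (bookGraph t) (G n ⊔ R)})
      atTop (𝓝 1) := by
  classical
  set s : ℕ := 2 * (2 * t + 1) with hs
  -- For `n ≥ 4 / α ^ 4` the degenerate term costs at most half of `α ^ 4 * n ^ 4`, leaving `α ^ 4 *
  -- n ^ 4 / 8` joined pairs, which is at least `c * (n.choose 2) ^ 2`.
  set c : ℝ := α ^ 4 / 2 with hc
  have hc0 : 0 < c := by positivity
  set δ : ℝ := (c / 4) ^ (s * s) with hδ
  have hδ0 : 0 < δ := by positivity
  set ε : ℝ := min (min (1 / 2) (c / 2)) (δ / (8 * (s : ℝ) ^ 2 + 1)) with hε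
  have hε0 : 0 < ε := lt_min (lt_min (by norm_num) (by positivity)) (by positivity)
  have hε2 : ε ≤ 1 / 2 := (min_le_left _ _).trans (min_le_left _ _)
  have hεc : 2 * ε ≤ c := by
    have : ε ≤ c / 2 := (min_le_left _ _).trans (min_le_right _ _)
    linarith
  have hεδ : 2 * (s : ℝ) ^ 2 * (4 * ε) < δ := by
    have : ε ≤ δ / (8 * (s : ℝ) ^ 2 + 1) := min_le_right _ _
    rw [le_div_iff₀ (by positivity)] at this
    linarith
  have hlim := tendsto_choose_two_mul_atTop hp
  have hbound : ∀ᶠ n : ℕ in atTop,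
      1 - ENNReal.ofReal (42 / (ε ^ 2 * ((n.choose 2 : ℝ) * p n))) ≤
      SimpleGraph.binomialRandom (Fin n) (p n)
        {R : SimpleGraph (Fin n) | MakerWinsGraphGame first (bookGraph t) (G n ⊔ R)} := by
    filter_upwards [hG, hlim.eventually_ge_atTop 1, eventually_ge_atTop 2,
      tendsto_natCast_atTop_atTop.eventually_ge_atTop (4 / α ^ 4),
      tendsto_natCast_atTop_atTop.eventually_ge_atTop (16 / ε)] with n hGn hx hn2 hnα hnε
    have hn2' : (2 : ℝ) ≤ n := by exact_mod_cast hn2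
    rw [div_le_iff₀ (by positivity)] at hnα hnε
    have hN : (SimpleGraph.edgeFinset (⊤ : SimpleGraph (Fin n))).card = n.choose 2 := by
      rw [SimpleGraph.card_edgeFinset_top_eq_card_choose_two, Fintype.card_fin]
    have hN1 : (n.choose 2 : ℝ) ≤ (n : ℝ) ^ 2 / 2 := by rw [Nat.cast_choose_two]; nlinarith
    have hN2 : (n : ℝ) ^ 2 / 4 ≤ n.choose 2 := by rw [Nat.cast_choose_two]; nlinarith
    have hn3 : (0 : ℝ) ≤ (n : ℝ) ^ 3 := by positivity
    have hΓ := pow_mul_le_card_edgePairs_completelyJoined (G n) hα.le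
      (by rw [Fintype.card_fin]; omega) (by rw [Fintype.card_fin]; exact hGn)
    have hZ : ((edgePairs (ShareVertex (V := Fin n))).card : ℝ) ≤ (n : ℝ) ^ 3 := by
      have := card_edgePairs_shareVertex_le (V := Fin n)
      rw [Fintype.card_fin] at this
      exact_mod_cast this
    rw [Fintype.card_fin] at hΓ
    have hlose := binomialRandom_not_makerWins_le first t (G n) (p n) hε0 hε2 hεc hεδ
      (x := (n.choose 2 : ℝ) * p n) (by rw [← hN]) hx ?_ ?_
    -- Subadditivity of the measure suffices, so measurability of the winning event plays no role.
    · rw [tsub_le_iff_right]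
      have huniv : (1 : ENNReal) = SimpleGraph.binomialRandom (Fin n) (p n)
          ({R | MakerWinsGraphGame first (bookGraph t) (G n ⊔ R)} ∪
            {R | ¬ MakerWinsGraphGame first (bookGraph t) (G n ⊔ R)}) := by
        have hset : ({R | MakerWinsGraphGame first (bookGraph t) (G n ⊔ R)} ∪
            {R | ¬ MakerWinsGraphGame first (bookGraph t) (G n ⊔ R)} :
              Set (SimpleGraph (Fin n))) = Set.univ :=
          Set.eq_univ_of_forall fun R => em _
        rw [hset, MeasureTheory.measure_univ]
      rw [huniv]
      exact (MeasureTheory.measure_union_le _ _).trans (add_le_add le_rfl hlose)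
    · have hNsq : (n.choose 2 : ℝ) ^ 2 ≤ (n : ℝ) ^ 4 / 4 := by
        have := pow_le_pow_left₀ (by positivity) hN1 2
        linarith
      have h1 := mul_le_mul_of_nonneg_left hNsq hc0.le
      have h2 := mul_le_mul_of_nonneg_right hnα hn3
      convert (show c * (n.choose 2 : ℝ) ^ 2 ≤
        ((edgePairs (CompletelyJoined (G n))).card : ℝ) by rw [hc] at h1 ⊢; nlinarith) using 3
      rw [← hN]
    · have hNsq : (n : ℝ) ^ 4 / 16 ≤ (n.choose 2 : ℝ) ^ 2 := by
        have := pow_le_pow_left₀ (by positivity) hN2 2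
        linarith
      have h1 := mul_le_mul_of_nonneg_left hNsq hε0.le
      have h2 := mul_le_mul_of_nonneg_right hnε hn3
      convert (show ((edgePairs (ShareVertex (V := Fin n))).card : ℝ) ≤
        ε * (n.choose 2 : ℝ) ^ 2 by nlinarith) using 3
      rw [← hN]
  refine tendsto_of_tendsto_of_tendsto_of_le_of_le' ?_ tendsto_const_nhds hbound
    (Eventually.of_forall fun n => MeasureTheory.prob_le_one)
  have h1 : Tendsto (fun n : ℕ => 42 / (ε ^ 2 * ((n.choose 2 : ℝ) * p n))) atTop (𝓝 0) :=
    tendsto_const_nhds.div_atTop (hlim.const_mul_atTop (by positivity))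
  have h2 := ENNReal.tendsto_ofReal h1
  rw [ENNReal.ofReal_zero] at h2
  have h3 := ENNReal.Tendsto.sub (tendsto_const_nhds (x := (1 : ENNReal))) h2
    (.inl ENNReal.one_ne_top)
  simpa using h3
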